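/- Let $E,A\in\mathbb R^{n_x\times n_x}$, $B\in\mathbb R^{n_x\times n_v}$, $C\in\mathbb R^{n_y\times n_x}$, $D\in\mathbb R^{n_y\times n_v}$. Assume that the pencil $\lambda E-A$ is regular, i.e. $\det(\lambda E-A)\neq 0$ for some $\lambda\in\mathbb C$, and that the system is R-controllable, i.e. $\operatorname{rk}[\lambda E-A\;\; B]=n_x$ for all $\lambda\in\mathbb C$. Let $n_J$ be the dimension of the dynamical part and $\delta$ the structured nilpotency index: for a quasi-Weierstraß form $$S(\lambda E-A)P=\lambda\begin{bmatrix}I_{n_J}&\\&N\end{bmatrix}-\begin{bmatrix}J&\\&I_{n_N}\end{bmatrix}$$ with $S,P$ invertible, $n_J+n_N=n_x$, $N\in\mathbb R^{n_N\times n_N}$ nilpotent, and $SB=\begin{bmatrix}B_J\\B_N\end{bmatrix}$, let $\delta=\min\{i\in\mathbb N: N^iB_N=0\}$ if $n_N>0$ and $B_N\ne0$, and $\delta=1$ otherwise. Let $(\Omega,\mathcal F,\mathbb P)$ be a probability space and $(\phi^i)_{i\in\mathbb N}$ an orthogonal basis of $L^2(\Omega,\mathbb R)$. The $i$-th expansion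 (PCE) coefficient of $Z\in L^2(\Omega,\mathbb R^m)$ is $\mathsf z^i=\mathbb E[\phi^iZ]/\mathbb E[\phi^i\phi^i]\in\mathbb R^m$. Let $(V_k,Y_k)_{k\in\mathbb N}$ be a random-variable input-output trajectory, i.e. $V_k\in L^2(\Omega,\mathbb R^{n_v})$, $Y_k\in L^2(\Omega,\mathbb R^{n_y})$ and there are $X_k\in L^2(\Omega,\mathbb R^{n_x})$ with $$EX_{k+1}=AX_k+BV_k,\qquad Y_k=CX_k+DV_k\qquad(k\in\mathbb N)$$ almost surely, and let $(\mathsf v^i_k,\mathsf y^i_k)_{k\in\mathbb N}$ be its expansion coefficients. Let $(\hat v_k,\hat y_k)_{k\in\mathbb N}$ be a realization trajectory, i.e. real vector sequences for which there are $\hat x_k\in\mathbb R^{n_x}$ with $E\hat x_{k+1}=A\hat x_k+B\hat v_k$, $\hat y_k=C\hat x_k+D\hat v_k$ for all $k\in\mathbb N$. For a sequence $w$, let $\mathcal H_L(w_{[0,K]})$ be the block Hankel matrix with $K-L+2$ columns whose $j$-th column, $j=0,\dots,K-L+1$, is $(w_j^\top,\dots,w_{j+L-1}^\top)^\top$; $w_{[0,K]}$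 is persistently exciting of order $t$ if $\mathcal H_t(w_{[0,K]})$ has full row rank. Let $L,T\in\mathbb N$ and assume that $\hat v_{[0,T-1]}$ and, for every $i\in\mathbb N$, $\mathsf v^i_{[0,T-1]}$ are persistently exciting of order $L+n_J+\delta-1$. Then: (i) For all $i\in\mathbb N$, $$\operatorname{colsp}\begin{bmatrix}\mathcal H_L(\mathsf v^i_{[0,T-\delta]})\\\mathcal H_L(\mathsf y^i_{[0,T-\delta]})\end{bmatrix}=\operatorname{colsp}\begin{bmatrix}\mathcal H_L(\hat v_{[0,T-\delta]})\\\mathcal H_L(\hat y_{[0,T-\delta]})\end{bmatrix}.$$ (ii) For every $g\in\mathbb R^{T-L-\delta+2}$ there exists $G\in L^2(\Omega,\mathbb R^{T-L-\delta+2})$ such that, almost surely, $$\begin{bmatrix}\mathcal H_L(V_{[0,T-\delta]})\\\mathcal H_L(Y_{[0,T-\delta]})\end{bmatrix}g=\begin{bmatrix}\mathcal H_L(\hat v_{[0,T-\delta]})\\\mathcal H_L(\hat y_{[0,T-\delta]})\end{bmatrix}G.$$ -/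

import Mathlib

open MeasureTheory

/-- The pencil `λE - A` is regular. -/
def IsRegularPencil {nx : ℕ} (E A : Matrix (Fin nx) (Fin nx) ℝ) : Prop :=
  ∃ z : ℂ, (z • E.map Complex.ofReal - A.map Complex.ofReal).det ≠ 0

/-- R-controllability: `rk [λE - A, B] = nx` for every complex `λ`. -/
def IsRControllable {nx nv : ℕ} (E A : Matrix (Fin nx) (Fin nx) ℝ)
    (B : Matrix (Fin nx) (Fin nv) ℝ) : Prop :=
  ∀ z : ℂ, (Matrix.fromCols (z • E.map Complex.ofReal - A.map Complex.ofReal)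
    (B.map Complex.ofReal)).rank = nx

/-- The splitting of `Fin nx` into the first `nJ` and the last `nN` indices. -/
def blockEquiv {nx nJ nN : ℕ} (h : nJ + nN = nx) : Fin nJ ⊕ Fin nN ≃ Fin nx :=
  finSumFinEquiv.trans (finCongr h)

/-- A quasi-Weierstraß form `S (λE - A) P = λ diag(I, N) - diag(J, I)` of the pencil `λE - A`, with
`S`, `P` invertible and `N` nilpotent. -/
structure QuasiWeierstrassForm {nx : ℕ} (E A : Matrix (Fin nx) (Fin nx) ℝ) (nJ nN : ℕ) where
  dim_add : nJ + nN = nx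
  S : Matrix (Fin nx) (Fin nx) ℝ
  P : Matrix (Fin nx) (Fin nx) ℝ
  J : Matrix (Fin nJ) (Fin nJ) ℝ
  N : Matrix (Fin nN) (Fin nN) ℝ
  isUnit_S : IsUnit S
  isUnit_P : IsUnit P
  isNilpotent_N : IsNilpotent N
  transform_E : S * E * P =
    Matrix.reindex (blockEquiv dim_add) (blockEquiv dim_add) (Matrix.fromBlocks 1 0 0 N)
  transform_A : S * A * P =
    Matrix.reindex (blockEquiv dim_add) (blockEquiv dim_add) (Matrix.fromBlocks J 0 0 1)

/-- The lower block `B_N` of `S * B`. -/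
def QuasiWeierstrassForm.BN {nx nv nJ nN : ℕ} {E A : Matrix (Fin nx) (Fin nx) ℝ}
    (F : QuasiWeierstrassForm E A nJ nN) (B : Matrix (Fin nx) (Fin nv) ℝ) :
    Matrix (Fin nN) (Fin nv) ℝ :=
  Matrix.of fun i j => (F.S * B) (blockEquiv F.dim_add (Sum.inr i)) j

open Classical in
/-- The structured nilpotency index: the least `i` with `N ^ i * B_N = 0` if `nN > 0` and
`B_N ≠ 0`, and `1` otherwise. -/
noncomputable def QuasiWeierstrassForm.structuredIndex {nx nv nJ nN : ℕ}
    {E A : Matrix (Fin nx) (Fin nx) ℝ}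
    (F : QuasiWeierstrassForm E A nJ nN) (B : Matrix (Fin nx) (Fin nv) ℝ) : ℕ :=
  if 0 < nN ∧ F.BN B ≠ 0 then sInf {i : ℕ | F.N ^ i * F.BN B = 0} else 1

/-- The dynamical part of the system has dimension `nJ` and its structured nilpotency index
is `δ`, as read off from a quasi-Weierstraß form. -/
def HasDynamicDimAndIndex {nx nv : ℕ} (E A : Matrix (Fin nx) (Fin nx) ℝ)
    (B : Matrix (Fin nx) (Fin nv) ℝ) (nJ δ : ℕ) : Prop :=
  ∃ (nN : ℕ) (F : QuasiWeierstrassForm E A nJ nN), δ = F.structuredIndex B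

theorem exists_real_det_ne_zero {nx : ℕ} {E A : Matrix (Fin nx) (Fin nx) ℝ}
    (h : IsRegularPencil E A) : ∃ r : ℝ, (r • E - A).det ≠ 0 := by
  obtain ⟨z, hz⟩ := h
  set p : Polynomial ℝ :=
    ((Polynomial.X : Polynomial ℝ) • E.map Polynomial.C - A.map Polynomial.C).det with hp
  have key : ∀ (K : Type) [CommRing K] (f : ℝ →+* K) (x : K),
      Polynomial.eval₂ f x p = (x • E.map f - A.map f).det := by
    intro K _ f x
    rw [← Polynomial.coe_eval₂RingHom, hp, RingHom.map_det]
    congr 1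
    ext i j
    simp
    ring
  have hz' : Polynomial.eval₂ Complex.ofRealHom z p ≠ 0 := by
    rw [key]; exact hz
  have hp0 : p ≠ 0 := by
    intro h0; rw [h0] at hz'; exact hz' (Polynomial.eval₂_zero _ _)
  by_contra! hall
  apply hp0
  apply Polynomial.funext (R := ℝ)
  intro r
  have := key ℝ (RingHom.id ℝ) r
  rw [Polynomial.eval, this]
  simpa using hall r

/-- Every regular pencil has a quasi-Weierstraß form. -/
theorem exists_quasiWeierstrassForm {nx : ℕ} {E A : Matrix (Fin nx) (Fin nx) ℝ}
    (h : IsRegularPencil E A) :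
    ∃ nJ nN : ℕ, Nonempty (QuasiWeierstrassForm E A nJ nN) := by
  obtain ⟨r, hr⟩ := exists_real_det_ne_zero h
  set M := r • E - A with hM
  have hMu : IsUnit M.det := isUnit_iff_ne_zero.mpr hr
  set f : Module.End ℝ (Fin nx → ℝ) := Matrix.toLin' (M⁻¹ * E) with hf
  obtain ⟨n, hcompl, hn⟩ :=
    (f.eventually_isCompl_ker_pow_range_pow.and (Filter.eventually_ge_atTop 1)).exists
  set R := LinearMap.range (f ^ n)
  set K := LinearMap.ker (f ^ n)
  have hRf : ∀ v ∈ R, f v ∈ R := by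
    rintro _ ⟨w, rfl⟩
    exact ⟨f w, by rw [← Module.End.mul_apply, ← Module.End.mul_apply, ← pow_succ, pow_succ']⟩
  have hKf : ∀ v ∈ K, f v ∈ K := by
    intro v hv
    rw [LinearMap.mem_ker] at hv ⊢
    rw [← Module.End.mul_apply, ← pow_succ, pow_succ', Module.End.mul_apply, hv, map_zero]
  let bR := Module.finBasis ℝ R
  let bK := Module.finBasis ℝ K
  have hdim : Module.finrank ℝ R + Module.finrank ℝ K = nx := by
    have := LinearMap.finrank_range_add_finrank_ker (f ^ n)
    simpa using this
  let eq := Submodule.prodEquivOfIsCompl R K hcompl.symm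
  let b := (bR.prod bK).map eq
  let e := blockEquiv hdim
  let b' := b.reindex e
  -- blocks of `f` in the adapted basis
  set F := LinearMap.toMatrix b b f with hF
  have hbl : ∀ i, b (Sum.inl i) = (bR i : Fin nx → ℝ) := by intro i; simp [b, eq]
  have hbr : ∀ i, b (Sum.inr i) = (bK i : Fin nx → ℝ) := by intro i; simp [b, eq]
  have h12 : F.toBlocks₁₂ = 0 := by
    ext i j
    have hmem : f (b (Sum.inr j)) ∈ K := by rw [hbr]; exact hKf _ (bK j).2
    have : eq.symm (f (b (Sum.inr j))) = (0, ⟨_, hmem⟩) := by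
      rw [LinearEquiv.symm_apply_eq]; simp [eq]
    simp [Matrix.toBlocks₁₂, hF, LinearMap.toMatrix_apply]
    simp [b] at this ⊢
    simp [this]
  have h21 : F.toBlocks₂₁ = 0 := by
    ext i j
    have hmem : f (b (Sum.inl j)) ∈ R := by rw [hbl]; exact hRf _ (bR j).2
    have : eq.symm (f (b (Sum.inl j))) = (⟨_, hmem⟩, 0) := by
      rw [LinearEquiv.symm_apply_eq]; simp [eq]
    simp [Matrix.toBlocks₂₁, hF, LinearMap.toMatrix_apply]
    simp [b] at this ⊢
    simp [this]
  set F1 := F.toBlocks₁₁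
  set F2 := F.toBlocks₂₂
  have hFb : F = Matrix.fromBlocks F1 0 0 F2 := by
    rw [← h12, ← h21]; exact (Matrix.fromBlocks_toBlocks F).symm
  have hpow : ∀ m : ℕ, F ^ m = Matrix.fromBlocks (F1 ^ m) 0 0 (F2 ^ m) := by
    intro m
    rw [hFb, Matrix.fromBlocks_diagonal_pow]
  have hFm : F ^ n = LinearMap.toMatrix b b (f ^ n) := by
    rw [hF, LinearMap.toMatrix_pow]
  have hF2 : F2 ^ n = 0 := by
    ext i j
    have h1 : (F ^ n) (Sum.inr i) (Sum.inr j) = 0 := by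
      rw [hFm, LinearMap.toMatrix_apply, hbr, LinearMap.mem_ker.mp (bK j).2]
      simp
    rw [hpow] at h1
    simpa using h1
  have hF1 : IsUnit F1 := by
    rw [← Matrix.mulVec_injective_iff_isUnit]
    rw [← Matrix.coe_mulVecLin, ← LinearMap.ker_eq_bot, LinearMap.ker_eq_bot']
    intro c hc
    have hc' : F1.mulVec c = 0 := hc
    let d : Fin (Module.finrank ℝ R) ⊕ Fin (Module.finrank ℝ K) → ℝ := Sum.elim c 0
    have hFd : F.mulVec d = 0 := by
      rw [hFb, Matrix.fromBlocks_mulVec]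
      ext i
      rcases i with i | i
      · simpa [d, Function.comp_def, Matrix.mulVec, dotProduct] using congrFun hc' i
      · simp [d, Function.comp_def, Matrix.mulVec, dotProduct]
    let w := b.equivFun.symm d
    have hw : (b.repr w : _ → ℝ) = d := b.equivFun.apply_symm_apply d
    have hfw : f w = 0 := by
      have := LinearMap.toMatrix_mulVec_repr b b f w
      rw [hw, ← hF, hFd] at this
      have h0 : b.repr (f w) = 0 := by ext i; exact (congrFun this i).symm
      simpa using h0
    have hwR : w ∈ R := by
      simp only [w, Module.Basis.equivFun_symm_apply, Fintype.sum_sum_type, d, Sum.elim_inl,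
        Sum.elim_inr, Pi.zero_apply, zero_smul, Finset.sum_const_zero, add_zero]
      refine Submodule.sum_mem _ fun i _ => Submodule.smul_mem _ _ ?_
      rw [hbl]; exact (bR i).2
    have hwK : w ∈ K := by
      rw [LinearMap.mem_ker]
      obtain ⟨m, rfl⟩ : ∃ m, n = m + 1 := ⟨n - 1, by omega⟩
      rw [pow_succ, Module.End.mul_apply, hfw, map_zero]
    have hw0 : w = 0 := by
      have := hcompl.disjoint.le_bot ⟨hwK, hwR⟩
      simpa using this
    ext i
    have := congrFun hw (Sum.inl i)
    rw [hw0] at this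
    simpa [d] using this.symm
  -- the transformation matrices
  have hG2 : IsUnit (r • F2 - 1) := by
    have hnil : IsNilpotent (r • F2) := ⟨n, by rw [smul_pow, hF2, smul_zero]⟩
    simpa using (IsNilpotent.isUnit_sub_one hnil)
  have hF1' := (Matrix.isUnit_iff_isUnit_det _).mp hF1
  have hG2' := (Matrix.isUnit_iff_isUnit_det _).mp hG2
  let Q : Matrix (Fin nx) (Fin nx) ℝ := (Pi.basisFun ℝ (Fin nx)).toMatrix b'
  let Q' : Matrix (Fin nx) (Fin nx) ℝ := b'.toMatrix (Pi.basisFun ℝ (Fin nx))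
  have hQ : Q' * Q = 1 := b'.toMatrix_mul_toMatrix_flip _
  have hQ' : Q * Q' = 1 := (Pi.basisFun ℝ (Fin nx)).toMatrix_mul_toMatrix_flip _
  have hQE : Q' * (M⁻¹ * E) * Q = Matrix.reindex e e F := by
    have h1 : M⁻¹ * E = LinearMap.toMatrix (Pi.basisFun ℝ (Fin nx)) (Pi.basisFun ℝ (Fin nx)) f := by
      rw [hf, LinearMap.toMatrix_eq_toMatrix', LinearMap.toMatrix'_toLin']
    have h2 : Q' * (M⁻¹ * E) * Q = LinearMap.toMatrix b' b' f := by
      rw [h1]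
      exact basis_toMatrix_mul_linearMap_toMatrix_mul_basis_toMatrix _ _ _ _ f
    rw [h2]
    ext i j
    simp [b', hF, LinearMap.toMatrix_apply]
  have hA : M⁻¹ * A = r • (M⁻¹ * E) - 1 := by
    have : A = r • E - M := by rw [hM]; abel
    rw [this, Matrix.mul_sub, Matrix.nonsing_inv_mul _ hMu, Matrix.mul_smul]
  have hQA : Q' * (M⁻¹ * A) * Q = Matrix.reindex e e (r • F - 1) := by
    rw [hA, Matrix.mul_sub, Matrix.sub_mul, Matrix.mul_smul, Matrix.smul_mul, hQE, Matrix.mul_one,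
      hQ]
    ext i j
    simp [Matrix.one_apply]
  let Δ := Matrix.fromBlocks F1⁻¹ 0 0 (r • F2 - 1)⁻¹
  let Δ' := Matrix.fromBlocks F1 0 0 (r • F2 - 1)
  have hΔ : Δ * Δ' = 1 := by
    simp only [Δ, Δ', Matrix.fromBlocks_multiply]
    rw [Matrix.nonsing_inv_mul _ hF1', Matrix.nonsing_inv_mul _ hG2']
    simp [← Matrix.fromBlocks_one]
  have hre : ∀ X Z : Matrix (Fin (Module.finrank ℝ R) ⊕ Fin (Module.finrank ℝ K))
      (Fin (Module.finrank ℝ R) ⊕ Fin (Module.finrank ℝ K)) ℝ,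
      Matrix.reindex e e X * Matrix.reindex e e Z = Matrix.reindex e e (X * Z) := by
    intro X Z
    simp [Matrix.reindex_apply, Matrix.submatrix_mul_equiv]
  have hcomm : Commute (r • F2 - 1)⁻¹ F2 := by
    obtain ⟨u, hu⟩ := hG2
    have h1 : Commute (u : Matrix _ _ ℝ) F2 := by
      rw [hu]
      exact ((Commute.refl F2).smul_left r).sub_left (Commute.one_left F2)
    rw [← hu, ← Matrix.coe_units_inv]
    exact h1.units_inv_left
  have hunit : ∀ X Z : Matrix (Fin nx) (Fin nx) ℝ, X * Z = 1 → IsUnit X := fun X Z hXZ =>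
    ⟨⟨X, Z, hXZ, mul_eq_one_comm.mp hXZ⟩, rfl⟩
  refine ⟨_, _, ⟨hdim, Matrix.reindex e e Δ * Q' * M⁻¹, Q, F1⁻¹ * (r • F1 - 1),
    (r • F2 - 1)⁻¹ * F2, ?_, ?_, ?_, ?_, ?_⟩⟩
  · refine IsUnit.mul (IsUnit.mul ?_ ?_) ?_
    · refine hunit _ (Matrix.reindex e e Δ') ?_
      rw [hre, hΔ]; simp
    · exact hunit _ _ hQ
    · exact (Matrix.isUnit_nonsing_inv_iff).mpr ((Matrix.isUnit_iff_isUnit_det _).mpr hMu)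
  · exact hunit _ _ hQ'
  · exact ⟨n, by rw [hcomm.mul_pow, hF2, mul_zero]⟩
  · calc Matrix.reindex e e Δ * Q' * M⁻¹ * E * Q
        = Matrix.reindex e e Δ * (Q' * (M⁻¹ * E) * Q) := by simp only [Matrix.mul_assoc]
      _ = _ := by
        rw [hQE, hre, hFb]
        simp only [Δ, Matrix.fromBlocks_multiply]
        rw [Matrix.nonsing_inv_mul _ hF1']
        simp [e]
  · calc Matrix.reindex e e Δ * Q' * M⁻¹ * A * Q
        = Matrix.reindex e e Δ * (Q' * (M⁻¹ * A) * Q) := by simp only [Matrix.mul_assoc]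
      _ = _ := by
        have hsub : r • F - 1 = Matrix.fromBlocks (r • F1 - 1) 0 0 (r • F2 - 1) := by
          rw [hFb, ← Matrix.fromBlocks_one, Matrix.fromBlocks_smul, sub_eq_add_neg,
            Matrix.fromBlocks_neg, Matrix.fromBlocks_add]
          simp [sub_eq_add_neg]
        rw [hQA, hre, hsub]
        simp only [Δ, Matrix.fromBlocks_multiply]
        rw [Matrix.nonsing_inv_mul _ hG2']
        simp [e]

/-- Every regular system has a dynamical dimension and a structured nilpotency index. -/
theorem exists_hasDynamicDimAndIndex {nx nv : ℕ} {E A : Matrix (Fin nx) (Fin nx) ℝ}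
    (h : IsRegularPencil E A) (B : Matrix (Fin nx) (Fin nv) ℝ) :
    ∃ nJ δ : ℕ, HasDynamicDimAndIndex E A B nJ δ := by
  obtain ⟨nJ, nN, ⟨F⟩⟩ := exists_quasiWeierstrassForm h
  exact ⟨nJ, _, nN, F, rfl⟩

/-- `(v, y)` is an input-output trajectory (on all of `ℕ`) of the realization dynamics
`E x_{k+1} = A x_k + B v_k`, `y_k = C x_k + D v_k`. -/
def IsIOTrajectory {nx nv ny : ℕ} (E A : Matrix (Fin nx) (Fin nx) ℝ)
    (B : Matrix (Fin nx) (Fin nv) ℝ) (C : Matrix (Fin ny) (Fin nx) ℝ)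
    (D : Matrix (Fin ny) (Fin nv) ℝ) (v : ℕ → Fin nv → ℝ) (y : ℕ → Fin ny → ℝ) : Prop :=
  ∃ x : ℕ → Fin nx → ℝ,
    (∀ k, E.mulVec (x (k + 1)) = A.mulVec (x k) + B.mulVec (v k)) ∧
    (∀ k, y k = C.mulVec (x k) + D.mulVec (v k))

/-- `(V, Y)` is an input-output trajectory (on all of `ℕ`) of the dynamics
`E X_{k+1} = A X_k + B V_k`, `Y_k = C X_k + D V_k` in square-integrable random vectors; equality
of random vectors is almost sure equality. -/
def IsRandomIOTrajectory {Ω : Type*} [MeasurableSpace Ω] (P : Measure Ω) {nx nv ny : ℕ}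
    (E A : Matrix (Fin nx) (Fin nx) ℝ)
    (B : Matrix (Fin nx) (Fin nv) ℝ) (C : Matrix (Fin ny) (Fin nx) ℝ)
    (D : Matrix (Fin ny) (Fin nv) ℝ) (V : ℕ → Ω → Fin nv → ℝ) (Y : ℕ → Ω → Fin ny → ℝ) : Prop :=
  (∀ k, MemLp (V k) 2 P) ∧ (∀ k, MemLp (Y k) 2 P) ∧
  ∃ X : ℕ → Ω → Fin nx → ℝ, (∀ k, MemLp (X k) 2 P) ∧
    (∀ k, ∀ᵐ ω ∂P, E.mulVec (X (k + 1) ω) = A.mulVec (X k ω) + B.mulVec (V k ω)) ∧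
    (∀ k, ∀ᵐ ω ∂P, Y k ω = C.mulVec (X k ω) + D.mulVec (V k ω))

/-- `(φ i)` is an orthogonal basis of the Hilbert space `L²(Ω, ℝ)`. -/
structure IsOrthogonalBasisL2 {Ω : Type*} [MeasurableSpace Ω] (P : Measure Ω)
    (φ : ℕ → Lp ℝ 2 P) : Prop where
  ne_zero : ∀ i, φ i ≠ 0
  orthogonal : ∀ i j, i ≠ j → inner ℝ (φ i) (φ j) = 0
  dense : (Submodule.span ℝ (Set.range φ)).topologicalClosure = ⊤

/-- The `i`-th expansion (PCE) coefficient `E[φ i * Z] / E[φ i * φ i]` of a random vector `Z`. -/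
noncomputable def pceCoeff {Ω : Type*} [MeasurableSpace Ω] (P : Measure Ω)
    (φ : ℕ → Lp ℝ 2 P) {m : ℕ} (Z : Ω → Fin m → ℝ) (i : ℕ) : Fin m → ℝ :=
  fun j => (∫ ω, φ i ω * Z ω j ∂P) / ∫ ω, φ i ω * φ i ω ∂P

/-- The block Hankel matrix of depth `L` of the first `M` samples `w 0, …, w (M - 1)` of `w`: its
`j`-th column is `(w j, …, w (j + L - 1))`. -/
def hankel {m : ℕ} (L M : ℕ) (w : ℕ → Fin m → ℝ) :
    Matrix (Fin L × Fin m) (Fin (M + 1 - L)) ℝ :=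
  Matrix.of fun a j => w (a.1 + j) a.2

/-- The samples `w 0, …, w (M - 1)` are persistently exciting of order `t`: their Hankel matrix
of depth `t` has full row rank. -/
def IsPersistentlyExciting {m : ℕ} (t M : ℕ) (w : ℕ → Fin m → ℝ) : Prop :=
  (hankel t M w).rank = t * m

/-- The stacked Hankel matrix of `(v, y)` on the first `M` samples. -/
def stackedHankel {nv ny : ℕ} (L M : ℕ) (v : ℕ → Fin nv → ℝ) (y : ℕ → Fin ny → ℝ) :
    Matrix (Fin L × Fin nv ⊕ Fin L × Fin ny) (Fin (M + 1 - L)) ℝ :=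
  Matrix.fromRows (hankel L M v) (hankel L M y)

/-- The column space of a real matrix. -/
def colsp {ι κ : Type*} (M : Matrix ι κ ℝ) : Submodule ℝ (ι → ℝ) :=
  Submodule.span ℝ (Set.range M.col)

/-! ### Decoupled form of a descriptor system -/

/-! Both column spaces in (i) equal one subspace determined by the system alone. In quasi-Weierstraß
coordinates the nilpotent state is a finite combination of present and future inputs, and `N ^ δ *
B_N = 0` cuts the look-ahead at `δ - 1`. So `y_k` depends linearly on the state `x_k` of the pair
`(J, B_J)` and on `v_k, …, v_{k+δ-1}` (`exists_output_form`). An input-output window of length `L`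
is therefore the image, under a fixed linear map `windowMap`, of a state and `L + δ - 1` inputs.

By the Hautus argument, R-controllability makes `(J, B_J)` controllable. The input-state form of
Willems' lemma (`span_state_input_eq_top`) then says that, for an input exciting of order `L + δ - 1
+ nJ`, the observed pairs (state, input window) span everything. Hence the Hankel columns span the
range of `windowMap` (`colsp_stackedHankel_eq_range`).

Expansion coefficients are linear in the random vector, so they obey the same dynamics, which gives
(i). For (ii), almost every sample path is a trajectory, so its windows lie in this range; a linear
section of the realization Hankel matrix yields `G`, and linearity keeps it square-integrable. -/

namespace QuasiWeierstrassForm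

variable {nx nv nJ nN : ℕ} {E A : Matrix (Fin nx) (Fin nx) ℝ}

/-- The upper block `B_J` of `S * B`. -/
def BJ (F : QuasiWeierstrassForm E A nJ nN) (B : Matrix (Fin nx) (Fin nv) ℝ) :
    Matrix (Fin nJ) (Fin nv) ℝ :=
  Matrix.of fun i j => (F.S * B) (blockEquiv F.dim_add (Sum.inl i)) j

/-- The structured index is positive and annihilates the lower input block. -/
theorem structuredIndex_spec (F : QuasiWeierstrassForm E A nJ nN)
    (B : Matrix (Fin nx) (Fin nv) ℝ) :
    0 < F.structuredIndex B ∧ F.N ^ F.structuredIndex B * F.BN B = 0 := by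
  unfold structuredIndex
  split_ifs with h
  · obtain ⟨n, hn⟩ := F.isNilpotent_N
    have hmem := Nat.sInf_mem (s := {i : ℕ | F.N ^ i * F.BN B = 0}) ⟨n, by simp [hn]⟩
    refine ⟨Nat.pos_of_ne_zero fun h0 => h.2 ?_, hmem⟩
    rw [h0] at hmem
    simpa using hmem
  · refine ⟨one_pos, ?_⟩
    rcases Nat.eq_zero_or_pos nN with h0 | h0
    · subst h0
      ext i
      exact i.elim0
    · have : F.BN B = 0 := by tauto
      simp [this]

/-- The state in the coordinates of the quasi-Weierstraß form. -/
noncomputable def coord (F : QuasiWeierstrassForm E A nJ nN) (x : Fin nx → ℝ) :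
    Fin nJ ⊕ Fin nN → ℝ :=
  fun i => (F.P⁻¹.mulVec x) (blockEquiv F.dim_add i)

theorem mulVec_eq_coord {ι : Type*} (F : QuasiWeierstrassForm E A nJ nN)
    (M : Matrix ι (Fin nx) ℝ) (x : Fin nx → ℝ) :
    M.mulVec x = ((M * F.P).submatrix id (blockEquiv F.dim_add)).mulVec (F.coord x) := by
  have h := Matrix.submatrix_mulVec_equiv (M * F.P) (F.coord x) id (blockEquiv F.dim_add)
  rw [h]
  have h1 : F.coord x ∘ (blockEquiv F.dim_add).symm = F.P⁻¹.mulVec x := by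
    ext i
    simp [coord]
  rw [h1, Matrix.mulVec_mulVec, Matrix.mul_assoc,
    Matrix.mul_nonsing_inv _ ((Matrix.isUnit_iff_isUnit_det _).mp F.isUnit_P), Matrix.mul_one]
  rfl

theorem coord_dynamics (F : QuasiWeierstrassForm E A nJ nN) (B : Matrix (Fin nx) (Fin nv) ℝ)
    {x x' : Fin nx → ℝ} {v : Fin nv → ℝ} (h : E.mulVec x' = A.mulVec x + B.mulVec v) :
    F.coord x' ∘ Sum.inl = F.J.mulVec (F.coord x ∘ Sum.inl) + (F.BJ B).mulVec v ∧
    F.N.mulVec (F.coord x' ∘ Sum.inr) = F.coord x ∘ Sum.inr + (F.BN B).mulVec v := by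
  have h1 : (F.S * E).mulVec x' = (F.S * A).mulVec x + (F.S * B).mulVec v := by
    simp only [← Matrix.mulVec_mulVec, h, Matrix.mulVec_add]
  rw [F.mulVec_eq_coord, F.mulVec_eq_coord (F.S * A), F.transform_E, F.transform_A] at h1
  have h2 : ∀ (M : Matrix (Fin nJ ⊕ Fin nN) (Fin nJ ⊕ Fin nN) ℝ) (z : Fin nJ ⊕ Fin nN → ℝ) i,
      (((Matrix.reindex (blockEquiv F.dim_add) (blockEquiv F.dim_add) M).submatrix id
        (blockEquiv F.dim_add)).mulVec z) (blockEquiv F.dim_add i) = M.mulVec z i := by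
    intro M z i
    simp [Matrix.mulVec, dotProduct]
  constructor
  · ext i
    have := congrFun h1 (blockEquiv F.dim_add (Sum.inl i))
    rw [Pi.add_apply, h2, h2] at this
    rw [show (F.S * B).mulVec v (blockEquiv F.dim_add (Sum.inl i)) = (F.BJ B).mulVec v i from rfl]
      at this
    simpa [Matrix.fromBlocks_mulVec] using this
  · ext i
    have := congrFun h1 (blockEquiv F.dim_add (Sum.inr i))
    rw [Pi.add_apply, h2, h2] at this
    rw [show (F.S * B).mulVec v (blockEquiv F.dim_add (Sum.inr i)) = (F.BN B).mulVec v i from rfl]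
      at this
    simpa [Matrix.fromBlocks_mulVec] using this

end QuasiWeierstrassForm

/-- Solution of the nilpotent part of a descriptor system. -/
theorem nilpotent_state_eq {nN nv : ℕ} {N : Matrix (Fin nN) (Fin nN) ℝ} (hN : IsNilpotent N)
    {B : Matrix (Fin nN) (Fin nv) ℝ} {δ : ℕ} (hδ : N ^ δ * B = 0)
    {z : ℕ → Fin nN → ℝ} {v : ℕ → Fin nv → ℝ}
    (h : ∀ k, N.mulVec (z (k + 1)) = z k + B.mulVec (v k)) (k : ℕ) :
    z k = -∑ i ∈ Finset.range δ, (N ^ i * B).mulVec (v (k + i)) := by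
  have key : ∀ n, z k = (N ^ n).mulVec (z (k + n)) -
      ∑ i ∈ Finset.range n, (N ^ i * B).mulVec (v (k + i)) := by
    intro n
    induction n with
    | zero => simp
    | succ n ih =>
      have h1 : z (k + n) = N.mulVec (z (k + n + 1)) - B.mulVec (v (k + n)) := by
        rw [h]; simp
      rw [ih, Finset.sum_range_succ, h1, Matrix.mulVec_sub, Matrix.mulVec_mulVec,
        Matrix.mulVec_mulVec, ← pow_succ, add_assoc k n 1]
      abel
  obtain ⟨n, hn⟩ := hN
  -- After `n + δ` forward steps the terminal state has disappeared, and the summands from index `δ`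
  -- on contain the factor `N ^ δ * B = 0`.
  have hn' : N ^ (n + δ) = 0 := by rw [pow_add, hn, zero_mul]
  have hsum : ∑ i ∈ Finset.range n, (N ^ (δ + i) * B).mulVec (v (k + (δ + i))) = 0 :=
    Finset.sum_eq_zero fun i _ => by
      rw [add_comm δ i, pow_add, Matrix.mul_assoc, hδ]; simp
  rw [key (n + δ), hn', add_comm n δ, Finset.sum_range_add, hsum]
  simp

/-- Every input-output trajectory is driven by the dynamical part of the state and finitely many
present and future inputs. -/
theorem QuasiWeierstrassForm.exists_output_form {nx nv ny nJ nN : ℕ}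
    {E A : Matrix (Fin nx) (Fin nx) ℝ} (F : QuasiWeierstrassForm E A nJ nN)
    (B : Matrix (Fin nx) (Fin nv) ℝ) (C : Matrix (Fin ny) (Fin nx) ℝ)
    (D : Matrix (Fin ny) (Fin nv) ℝ) :
    ∃ (CJ : Matrix (Fin ny) (Fin nJ) ℝ) (K : ℕ → Matrix (Fin ny) (Fin nv) ℝ),
      ∀ v y, IsIOTrajectory E A B C D v y → ∃ x : ℕ → Fin nJ → ℝ,
        (∀ k, x (k + 1) = F.J.mulVec (x k) + (F.BJ B).mulVec (v k)) ∧
        ∀ k, y k = CJ.mulVec (x k) +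
          ∑ i ∈ Finset.range (F.structuredIndex B), (K i).mulVec (v (k + i)) := by
  set Q := (C * F.P).submatrix id (blockEquiv F.dim_add) with hQ
  obtain ⟨hδ0, hδ⟩ := F.structuredIndex_spec B
  -- The feedthrough `D` is absorbed in the term `i = 0`, which is present because the structured
  -- index is positive.
  refine ⟨Q.toCols₁, fun i => (if i = 0 then D else 0) - Q.toCols₂ * (F.N ^ i * F.BN B), ?_⟩
  rintro v y ⟨x, hx, hy⟩
  refine ⟨fun k => F.coord (x k) ∘ Sum.inl, fun k => (F.coord_dynamics B (hx k)).1, fun k => ?_⟩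
  have hz := nilpotent_state_eq F.isNilpotent_N hδ
    (z := fun k => F.coord (x k) ∘ Sum.inr) (fun k => (F.coord_dynamics B (hx k)).2) k
  have hC : C.mulVec (x k) = Q.toCols₁.mulVec (F.coord (x k) ∘ Sum.inl) +
      Q.toCols₂.mulVec (F.coord (x k) ∘ Sum.inr) := by
    rw [F.mulVec_eq_coord, ← hQ, ← Matrix.fromCols_mulVec, Matrix.fromCols_toCols]
  have hD : D.mulVec (v k) = ∑ i ∈ Finset.range (F.structuredIndex B),
      (if i = 0 then D else 0).mulVec (v (k + i)) := by
    rw [Finset.sum_eq_single 0]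
    · simp
    · intro i _ hi
      simp [hi]
    · intro h0
      exact absurd (Finset.mem_range.mpr hδ0) h0
  rw [hy, hC, hz, hD]
  simp only [Matrix.sub_mulVec, Finset.sum_sub_distrib, Matrix.mulVec_neg, Matrix.mulVec_sum,
    Matrix.mulVec_mulVec]
  abel

/-! ### Controllability of the dynamical part -/

theorem Matrix.vecMul_injective_of_rank_eq {ι κ K : Type*} [Fintype ι] [Fintype κ] [Field K]
    {M : Matrix ι κ K} (h : M.rank = Fintype.card ι) :
    Function.Injective fun v => Matrix.vecMul v M := by
  rw [Matrix.vecMul_injective_iff, linearIndependent_iff_card_eq_finrank_span, ← h,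
    Matrix.rank_eq_finrank_span_row]
  rfl

/-- A nonzero row vector annihilating all Markov directions `J ^ k * B` yields a left
eigenvector of `J` annihilating `B`. -/
theorem exists_left_eigenvector {n m : ℕ} {J : Matrix (Fin n) (Fin n) ℂ}
    {B : Matrix (Fin n) (Fin m) ℂ} {a : Fin n → ℂ} (ha : a ≠ 0)
    (h : ∀ k, Matrix.vecMul a (J ^ k * B) = 0) :
    ∃ (z : ℂ) (ξ : Fin n → ℂ), ξ ≠ 0 ∧ Matrix.vecMul ξ J = z • ξ ∧ Matrix.vecMul ξ B = 0 := by
  -- `W` is the left uncontrollable subspace: nonzero and invariant under `J`, hence over `ℂ` it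
  -- contains an eigenvector.
  let W : Submodule ℂ (Fin n → ℂ) := ⨅ k, LinearMap.ker (J ^ k * B).vecMulLinear
  have hW : ∀ ξ, ξ ∈ W ↔ ∀ k, Matrix.vecMul ξ (J ^ k * B) = 0 := by
    intro ξ
    simp [W]
  have hinv : ∀ ξ ∈ W, J.vecMulLinear ξ ∈ W := by
    intro ξ hξ
    rw [hW] at hξ ⊢
    intro k
    rw [Matrix.vecMulLinear_apply, Matrix.vecMul_vecMul, ← Matrix.mul_assoc, ← pow_succ', hξ]
  have : Nontrivial W := ⟨⟨⟨a, (hW a).2 h⟩, 0, fun h0 => ha (congrArg Subtype.val h0)⟩⟩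
  obtain ⟨z, hz⟩ := Module.End.exists_eigenvalue (J.vecMulLinear.restrict hinv)
  obtain ⟨ξ, hξ⟩ := hz.exists_hasEigenvector
  refine ⟨z, ξ, fun h0 => hξ.2 (Subtype.ext h0), ?_, ?_⟩
  · exact congrArg Subtype.val hξ.apply_eq_smul
  · simpa using (hW _).1 ξ.2 0

/-- Hautus test: otherwise some left eigenvector `ξ` of `J`, with eigenvalue `z`, kills `B_J`.
Padding `ξ` by zero on the nilpotent block and multiplying by `S` gives a nonzero row vector
annihilating `[zE - A, B]`, against the rank condition. -/
theorem QuasiWeierstrassForm.vecMul_eq_zero_of_isRControllable {nx nv nJ nN : ℕ}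
    {E A : Matrix (Fin nx) (Fin nx) ℝ} (F : QuasiWeierstrassForm E A nJ nN)
    {B : Matrix (Fin nx) (Fin nv) ℝ} (hctrl : IsRControllable E A B) {a : Fin nJ → ℝ}
    (h : ∀ k, Matrix.vecMul a (F.J ^ k * F.BJ B) = 0) : a = 0 := by
  by_contra ha
  let ι : ℝ →+* ℂ := Complex.ofRealHom
  have haC : (ι ∘ a) ≠ 0 := by
    intro h0
    apply ha
    ext i
    simpa [ι] using congrFun h0 i
  obtain ⟨z, ξ, hξ0, hξJ, hξB⟩ := exists_left_eigenvector (J := F.J.map ι) (B := (F.BJ B).map ι)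
    haC (fun k => by
      rw [← Matrix.map_pow, ← Matrix.map_mul]
      ext i
      have := RingHom.map_vecMul ι (F.J ^ k * F.BJ B) a i
      rw [h] at this
      rw [← this]
      simp)
  let e := blockEquiv F.dim_add
  let η : Fin nx → ℂ := Sum.elim ξ 0 ∘ e.symm
  let ζ := Matrix.vecMul η (F.S.map ι)
  have hη : ∀ M : Matrix (Fin nJ ⊕ Fin nN) (Fin nJ ⊕ Fin nN) ℂ,
      Matrix.vecMul η (Matrix.reindex e e M) = Matrix.vecMul (Sum.elim ξ 0) M ∘ e.symm := by
    intro M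
    ext j
    simp only [Matrix.vecMul, dotProduct, Function.comp_apply, η]
    rw [← Equiv.sum_comp e]
    simp
  have hre : ∀ M : Matrix (Fin nJ ⊕ Fin nN) (Fin nJ ⊕ Fin nN) ℝ,
      (Matrix.reindex e e M).map ι = Matrix.reindex e e (M.map ι) := fun M => rfl
  have hE : Matrix.vecMul ζ (E.map ι * F.P.map ι) = η := by
    rw [Matrix.vecMul_vecMul, ← Matrix.mul_assoc, ← Matrix.map_mul, ← Matrix.map_mul,
      F.transform_E, hre, hη, Matrix.fromBlocks_map, Matrix.vecMul_fromBlocks]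
    ext i
    simp [η]
  have hA : Matrix.vecMul ζ (A.map ι * F.P.map ι) = z • η := by
    rw [Matrix.vecMul_vecMul, ← Matrix.mul_assoc, ← Matrix.map_mul, ← Matrix.map_mul,
      F.transform_A, hre, hη, Matrix.fromBlocks_map, Matrix.vecMul_fromBlocks]
    ext i
    rcases hi : e.symm i with j | j <;> simp [η, hi, hξJ]
  have hB : Matrix.vecMul ζ (B.map ι) = 0 := by
    rw [Matrix.vecMul_vecMul, ← Matrix.map_mul]
    ext j
    have := congrFun hξB j
    simp only [Matrix.vecMul, dotProduct, η] at this ⊢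
    rw [← Equiv.sum_comp e]
    simpa [QuasiWeierstrassForm.BJ] using this
  have hP : IsUnit (F.P.map ι) := F.isUnit_P.map ι.mapMatrix
  have hS : IsUnit (F.S.map ι) := F.isUnit_S.map ι.mapMatrix
  have hpencil : Matrix.vecMul ζ (z • E.map ι - A.map ι) = 0 := by
    apply Matrix.vecMul_injective_of_isUnit hP
    rw [Matrix.vecMul_sub, Matrix.vecMul_smul]
    simp only [Matrix.sub_vecMul, Matrix.smul_vecMul, Matrix.vecMul_vecMul, hE, hA, sub_self,
      Matrix.zero_vecMul]
  have hζ : ζ = 0 := by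
    apply Matrix.vecMul_injective_of_rank_eq ((hctrl z).trans (Fintype.card_fin nx).symm)
    refine (Matrix.vecMul_fromCols _ _ _).trans ?_
    refine (congrArg₂ Sum.elim hpencil hB).trans ?_
    refine Eq.trans ?_ (Matrix.zero_vecMul _).symm
    ext i
    rcases i with i | i <;> rfl
  have hη0 : η = 0 := by
    apply Matrix.vecMul_injective_of_isUnit hS
    simpa [ζ] using hζ
  apply hξ0
  ext i
  simpa [η] using congrFun hη0 (e (Sum.inl i))

/-! ### Willems' fundamental lemma in input-state form -/

/-- Full row rank means trivial left kernel; the functionals `w l` are the blocks of a row vector in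
that kernel. -/
theorem IsPersistentlyExciting.dual_eq_zero {m t M : ℕ} {v : ℕ → Fin m → ℝ}
    (h : IsPersistentlyExciting t M v) {w : ℕ → Module.Dual ℝ (Fin m → ℝ)}
    (hw : ∀ j < M + 1 - t, ∑ l ∈ Finset.range t, w l (v (l + j)) = 0) {l : ℕ} (hl : l < t) :
    w l = 0 := by
  let ζ : Fin t × Fin m → ℝ := fun a => w a.1 (Pi.single a.2 1)
  have hζ : ζ = 0 := by
    apply Matrix.vecMul_injective_of_rank_eq (M := hankel t M v)
      (h.trans (by simp))
    simp only [Matrix.zero_vecMul]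
    ext j
    have := hw j j.2
    rw [Finset.sum_range] at this
    simp only [Matrix.vecMul, dotProduct, Fintype.sum_prod_type, Pi.zero_apply]
    rw [← this]
    refine Finset.sum_congr rfl fun i _ => ?_
    rw [LinearMap.pi_apply_eq_sum_univ (w i) (v (i + j))]
    simp only [hankel, Matrix.of_apply, ζ, smul_eq_mul]
    refine Finset.sum_congr rfl fun c _ => ?_
    rw [mul_comm]
    congr 2
    ext d
    simp [Pi.single_apply, eq_comm]
  refine LinearMap.pi_ext' fun c => LinearMap.ext_ring ?_
  simpa [ζ] using congrFun hζ (⟨l, hl⟩, c)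

section Willems

variable {X U : Type*} [AddCommGroup X] [Module ℝ X] [AddCommGroup U] [Module ℝ U]

theorem linear_state_eq {J : X →ₗ[ℝ] X} {B : U →ₗ[ℝ] X} {x : ℕ → X} {v : ℕ → U}
    (h : ∀ k, x (k + 1) = J (x k) + B (v k)) (j i : ℕ) :
    x (j + i) = (J ^ i) (x j) + ∑ l ∈ Finset.range i, (J ^ (i - 1 - l)) (B (v (l + j))) := by
  induction i with
  | zero => simp
  | succ i ih =>
    rw [← add_assoc, h, ih, Finset.sum_range_succ, map_add, map_sum, pow_succ',
      Module.End.mul_apply, add_comm j i, add_assoc]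
    congr 2
    · refine Finset.sum_congr rfl fun l hl => ?_
      rw [Finset.mem_range] at hl
      rw [← Module.End.mul_apply, ← pow_succ']
      congr 3
      omega
    · simp

/-- The two-sided sequence of functionals made of the input coefficients `β` and the Markov
functionals `α ∘ J ^ k ∘ B`. -/
def markovSeq (J : X →ₗ[ℝ] X) (B : U →ₗ[ℝ] X) (α : Module.Dual ℝ X)
    (β : ℕ → Module.Dual ℝ U) : ℤ → Module.Dual ℝ U
  | Int.ofNat k => β k
  | Int.negSucc k => α ∘ₗ (J ^ k) ∘ₗ B

/-- A functional on the data at time `j + i` is rewritten on the data at time `j`: the negative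
indices carry the inputs that entered the state in between. The summation range does not depend on
`i`, so the relations for different `i` can be combined linearly. -/
theorem markovSeq_shift {J : X →ₗ[ℝ] X} {B : U →ₗ[ℝ] X} {α : Module.Dual ℝ X}
    {β : ℕ → Module.Dual ℝ U} {x : ℕ → X} {v : ℕ → U}
    (h : ∀ k, x (k + 1) = J (x k) + B (v k)) {K n i : ℕ} (hi : i ≤ n)
    (hβ : ∀ l, K ≤ l → β l = 0) (j : ℕ) :
    α ((J ^ i) (x j)) + ∑ l ∈ Finset.range (K + n), markovSeq J B α β (l - i) (v (l + j)) =
      α (x (j + i)) + ∑ l ∈ Finset.range K, β l (v (l + (j + i))) := by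
  have hpast : ∑ l ∈ Finset.range i, markovSeq J B α β (l - i) (v (l + j)) =
      ∑ l ∈ Finset.range i, α ((J ^ (i - 1 - l)) (B (v (l + j)))) := by
    refine Finset.sum_congr rfl fun l hl => ?_
    rw [Finset.mem_range] at hl
    rw [show (l : ℤ) - i = Int.negSucc (i - 1 - l) by omega]
    rfl
  have hfut : ∀ l : ℕ, markovSeq J B α β (((i + l : ℕ) : ℤ) - i) = β l := by
    intro l
    rw [show ((i + l : ℕ) : ℤ) - i = Int.ofNat l by simp]
    rfl
  have hzero : ∑ l ∈ Finset.range (n - i), β (K + l) (v (i + (K + l) + j)) = 0 :=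
    Finset.sum_eq_zero fun l _ => by rw [hβ _ (Nat.le_add_right _ _)]; rfl
  rw [show K + n = i + (K + (n - i)) by omega, Finset.sum_range_add, hpast]
  simp only [hfut]
  rw [Finset.sum_range_add, hzero, add_zero, linear_state_eq h j i, map_add, map_sum, add_assoc]
  congr 2
  refine Finset.sum_congr rfl fun l _ => ?_
  rw [show i + l + j = l + (j + i) by ring]

end Willems

/-- A controllable pair driven by a sufficiently exciting input explores all states and input
windows. -/
theorem span_state_input_eq_top {n m K T : ℕ} {J : (Fin n → ℝ) →ₗ[ℝ] Fin n → ℝ}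
    {B : (Fin m → ℝ) →ₗ[ℝ] Fin n → ℝ}
    (hctrl : ∀ α : Module.Dual ℝ (Fin n → ℝ), (∀ k, α ∘ₗ (J ^ k) ∘ₗ B = 0) → α = 0)
    {x : ℕ → Fin n → ℝ} {v : ℕ → Fin m → ℝ} (h : ∀ k, x (k + 1) = J (x k) + B (v k))
    (hpe : IsPersistentlyExciting (K + n) T v) :
    Submodule.span ℝ (Set.range fun j : Fin (T + 1 - K) =>
      ((x j, fun l => v (l + j)) : (Fin n → ℝ) × (Fin K → Fin m → ℝ))) = ⊤ := by
  by_contra hne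
  -- A nonzero functional `f = (α, β)` annihilating all the data is to be refuted.
  obtain ⟨f, hf0, hf⟩ := Submodule.exists_le_ker_of_lt_top _ (lt_top_iff_ne_top.mpr hne)
  apply hf0
  let α : Module.Dual ℝ (Fin n → ℝ) := f ∘ₗ LinearMap.inl ℝ _ _
  let β : ℕ → Module.Dual ℝ (Fin m → ℝ) := fun l =>
    if hl : l < K then f ∘ₗ LinearMap.inr ℝ _ _ ∘ₗ LinearMap.single ℝ (fun _ : Fin K => Fin m → ℝ) ⟨l, hl⟩ else 0
  have hf' : ∀ ξ u, f (ξ, u) = α ξ + ∑ l : Fin K, β l (u l) := by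
    intro ξ u
    have h1 : (ξ, u) = LinearMap.inl ℝ _ _ ξ +
        ∑ l, LinearMap.inr ℝ (Fin n → ℝ) _ (LinearMap.single ℝ _ l (u l)) := by
      rw [← map_sum]
      simp [LinearMap.single_apply, Finset.univ_sum_single]
    rw [h1, map_add, map_sum]
    simp [α, β]
  have hβ : ∀ l, K ≤ l → β l = 0 := fun l hl => by simp [β, not_lt.mpr hl]
  have hrel : ∀ j < T + 1 - K, α (x j) + ∑ l ∈ Finset.range K, β l (v (l + j)) = 0 := by
    intro j hj
    have := hf (Submodule.subset_span (Set.mem_range_self (⟨j, hj⟩ : Fin (T + 1 - K))))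
    rw [LinearMap.mem_ker, hf'] at this
    rwa [Finset.sum_range]
  let u := markovSeq J B α β
  let p := J.charpoly
  have hdeg : p.natDegree = n := by simp [p, LinearMap.charpoly_natDegree]
  have hlead : p.coeff n = 1 := by
    rw [← hdeg]; exact J.charpoly_monic
  have hCH : ∀ y, ∑ i ∈ Finset.range (n + 1), p.coeff i • (J ^ i) y = 0 := by
    intro y
    have h1 := LinearMap.aeval_self_charpoly J
    rw [Polynomial.aeval_eq_sum_range, show J.charpoly.natDegree = n from hdeg] at h1
    have := LinearMap.congr_fun h1 y
    simpa using this
  -- The characteristic polynomial gives a recurrence on all of `ℤ`. For `0 ≤ l < K + n`,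
  -- Cayley–Hamilton removes the state from the combined shifted relations and excitation applies;
  -- for `l ≥ K + n` all terms vanish; for `l < 0` it is Cayley–Hamilton on the Markov functionals.
  have hrec : ∀ l : ℤ, ∑ i ∈ Finset.range (n + 1), p.coeff i • u (l - i) = 0 := by
    intro l
    rcases l with l | l
    · rcases lt_or_ge l (K + n) with hl | hl
      · refine hpe.dual_eq_zero
          (w := fun l : ℕ => ∑ i ∈ Finset.range (n + 1), p.coeff i • u (l - i)) ?_ hl
        intro j hj
        have h1 : ∀ i ∈ Finset.range (n + 1), p.coeff i • (α ((J ^ i) (x j)) +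
            ∑ l ∈ Finset.range (K + n), u (l - i) (v (l + j))) = 0 := by
          intro i hi
          rw [Finset.mem_range] at hi
          rw [markovSeq_shift h (by omega : i ≤ n) hβ, hrel _ (by omega), smul_zero]
        have h2 := Finset.sum_eq_zero h1
        simp only [smul_add, Finset.sum_add_distrib] at h2
        have h3 := congrArg α (hCH (x j))
        simp only [map_sum, map_smul, map_zero] at h3
        rw [h3, zero_add] at h2
        simp only [Finset.smul_sum] at h2
        rw [Finset.sum_comm] at h2
        simpa [LinearMap.sum_apply] using h2
      · refine Finset.sum_eq_zero fun i hi => ?_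
        rw [Finset.mem_range] at hi
        rw [show Int.ofNat l - (i : ℤ) = Int.ofNat (l - i) by simp; omega]
        change p.coeff i • β (l - i) = 0
        rw [hβ _ (by omega), smul_zero]
    · have h1 : ∀ i : ℕ, u (Int.negSucc l - i) = α ∘ₗ (J ^ (l + i)) ∘ₗ B := by
        intro i
        rw [show Int.negSucc l - (i : ℤ) = Int.negSucc (l + i) by omega]
        rfl
      refine LinearMap.ext fun y => ?_
      have h2 : α ((J ^ l) (∑ i ∈ Finset.range (n + 1), p.coeff i • (J ^ i) (B y))) = 0 := by
        rw [hCH, map_zero, map_zero]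
      simpa [h1, LinearMap.sum_apply, map_sum, pow_add, LinearMap.comp_apply,
        Module.End.mul_apply] using h2
  -- The leading coefficient `1` multiplies the lowest index `l - n`, so vanishing from `K` on
  -- propagates downwards.
  have hu : ∀ (d : ℕ) (m : ℤ), (K : ℤ) - d ≤ m → u m = 0 := by
    intro d
    induction d with
    | zero =>
      intro m hm
      obtain ⟨k, rfl⟩ := Int.eq_ofNat_of_zero_le (a := m) (by omega)
      exact hβ k (by omega)
    | succ d ih =>
      intro m hm
      have h1 := hrec (m + n)
      rw [Finset.sum_range_succ, hlead, Finset.sum_eq_zero, zero_add, one_smul] at h1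
      · simpa using h1
      · intro i hi
        rw [Finset.mem_range] at hi
        rw [ih _ (by push_cast at hm; omega), smul_zero]
  have hu0 : ∀ m, u m = 0 := fun m => hu ((K : ℤ) - m).toNat m (by omega)
  have hα : α = 0 := hctrl α fun k => hu0 (Int.negSucc k)
  refine LinearMap.ext fun ⟨ξ, w⟩ => ?_
  rw [hf', hα]
  simp [show ∀ k, β k = 0 from fun k => hu0 (Int.ofNat k)]

/-! ### Windows of trajectories -/

section Window

variable {n m p : ℕ} (J : Matrix (Fin n) (Fin n) ℝ) (B : Matrix (Fin n) (Fin m) ℝ)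
  (C : Matrix (Fin p) (Fin n) ℝ) (D : ℕ → Matrix (Fin p) (Fin m) ℝ) (K δ L : ℕ)

/-- The `l`-th input of a pair of an initial state and an input window of length `K`. -/
noncomputable def inputAt (n m K l : ℕ) :
    ((Fin n → ℝ) × (Fin K → Fin m → ℝ)) →ₗ[ℝ] Fin m → ℝ :=
  if h : l < K then LinearMap.proj ⟨l, h⟩ ∘ₗ LinearMap.snd ℝ _ _ else 0

/-- The state reached after `l` steps from an initial state under an input window. -/
noncomputable def stateAt : ℕ → ((Fin n → ℝ) × (Fin K → Fin m → ℝ)) →ₗ[ℝ] Fin n → ℝ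
  | 0 => LinearMap.fst ℝ _ _
  | l + 1 => J.mulVecLin ∘ₗ stateAt l + B.mulVecLin ∘ₗ inputAt n m K l

/-- The input-output window of length `L` generated by an initial state and an input window. -/
noncomputable def windowMap : ((Fin n → ℝ) × (Fin K → Fin m → ℝ)) →ₗ[ℝ]
    (Fin L × Fin m ⊕ Fin L × Fin p → ℝ) :=
  LinearMap.pi (Sum.elim (fun a => LinearMap.proj a.2 ∘ₗ inputAt n m K a.1) fun a =>
    LinearMap.proj a.2 ∘ₗ (C.mulVecLin ∘ₗ stateAt J B K a.1 +
      ∑ i ∈ Finset.range δ, (D i).mulVecLin ∘ₗ inputAt n m K (a.1 + i)))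

variable {K} {x : ℕ → Fin n → ℝ} {v : ℕ → Fin m → ℝ}

theorem inputAt_window {l : ℕ} (hl : l < K) (ξ : Fin n → ℝ) (j : ℕ) :
    inputAt n m K l (ξ, fun l => v (l + j)) = v (l + j) := by
  simp [inputAt, hl]

variable {J B}

theorem stateAt_window (h : ∀ k, x (k + 1) = J.mulVec (x k) + B.mulVec (v k)) {l : ℕ}
    (hl : l ≤ K) (j : ℕ) : stateAt J B K l (x j, fun l => v (l + j)) = x (l + j) := by
  induction l with
  | zero => simp [stateAt]
  | succ l ih =>
    rw [show l + 1 + j = l + j + 1 by ring, h]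
    simp [stateAt, ih (by omega), inputAt_window (show l < K by omega)]

variable {C D δ L} {y : ℕ → Fin p → ℝ}

/-- The last output of the window looks ahead to input `(L - 1) + (δ - 1) = K - 1`, so `K = L + δ -
1` inputs suffice and no default value of `inputAt` is read. -/
theorem windowMap_window (h : ∀ k, x (k + 1) = J.mulVec (x k) + B.mulVec (v k))
    (hy : ∀ k, y k = C.mulVec (x k) + ∑ i ∈ Finset.range δ, (D i).mulVec (v (k + i)))
    (hδ : 0 < δ) (hK : K = L + δ - 1) {M : ℕ} (j : Fin (M + 1 - L)) :
    windowMap J B C D K δ L (x j, fun l => v (l + j)) = (stackedHankel L M v y).col j := by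
  ext a
  rcases a with ⟨a, c⟩ | ⟨a, c⟩
  · simp [windowMap, stackedHankel, hankel, inputAt_window (show (a : ℕ) < K by omega)]
  · have hsum : ∑ i ∈ Finset.range δ, (D i).mulVec
        (inputAt n m K (a + i) (x j, fun l => v (l + j))) =
        ∑ i ∈ Finset.range δ, (D i).mulVec (v (a + j + i)) := by
      refine Finset.sum_congr rfl fun i hi => ?_
      rw [Finset.mem_range] at hi
      rw [inputAt_window (by omega), add_right_comm]
    have := congrFun hsum c
    simp [windowMap, stackedHankel, hankel, stateAt_window h (show (a : ℕ) ≤ K by omega), hy,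
      LinearMap.sum_apply] at this ⊢
    exact this

/-- Under persistency of excitation, the columns of the stacked Hankel matrix span all windows of
the system. -/
theorem colsp_stackedHankel_eq_range
    (hctrl : ∀ a : Fin n → ℝ, (∀ k, Matrix.vecMul a (J ^ k * B) = 0) → a = 0)
    (h : ∀ k, x (k + 1) = J.mulVec (x k) + B.mulVec (v k))
    (hy : ∀ k, y k = C.mulVec (x k) + ∑ i ∈ Finset.range δ, (D i).mulVec (v (k + i)))
    (hδ : 0 < δ) (hL : 0 < L) {T : ℕ} (hpe : IsPersistentlyExciting (L + n + δ - 1) T v) :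
    colsp (stackedHankel L (T + 1 - δ) v y) =
      LinearMap.range (windowMap J B C D (L + δ - 1) δ L) := by
  have hctrl' : ∀ α : Module.Dual ℝ (Fin n → ℝ),
      (∀ k, α ∘ₗ (J.mulVecLin ^ k) ∘ₗ B.mulVecLin = 0) → α = 0 := by
    intro α hα
    let a : Fin n → ℝ := fun i => α (Pi.single i 1)
    have hα' : ∀ ξ, α ξ = a ⬝ᵥ ξ := by
      intro ξ
      rw [LinearMap.pi_apply_eq_sum_univ α ξ]
      simp only [dotProduct, a, smul_eq_mul]
      refine Finset.sum_congr rfl fun c _ => ?_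
      rw [mul_comm]
      congr 2
      ext d
      simp [Pi.single_apply, eq_comm]
    have ha : a = 0 := by
      refine hctrl a fun k => ?_
      ext c
      have h1 := LinearMap.congr_fun (hα k) (Pi.single c 1)
      have h2 : J.mulVecLin ^ k = (J ^ k).mulVecLin := by
        have := Matrix.toLin'_pow J k
        simpa [Matrix.toLin'_apply'] using this.symm
      rw [h2, LinearMap.comp_apply, LinearMap.comp_apply, hα', Matrix.mulVecLin_apply,
        Matrix.mulVecLin_apply, Matrix.mulVec_mulVec, Matrix.dotProduct_mulVec] at h1
      simpa using h1
    refine LinearMap.ext fun ξ => ?_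
    simp [hα', ha]
  have hspan := span_state_input_eq_top (K := L + δ - 1) (T := T) hctrl'
    (x := x) (v := v) (by simpa using h)
    (by rwa [show L + δ - 1 + n = L + n + δ - 1 by omega])
  rw [← Submodule.map_top, ← hspan, Submodule.map_span, ← Set.range_comp, colsp]
  congr 1
  -- With truncated subtraction, this count of columns relies on `0 < L`.
  have hcard : T + 1 - δ + 1 - L = T + 1 - (L + δ - 1) := by omega
  ext s
  constructor
  · rintro ⟨j, rfl⟩
    exact ⟨Fin.cast hcard j, windowMap_window h hy hδ rfl j⟩
  · rintro ⟨j, rfl⟩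
    exact ⟨Fin.cast hcard.symm j, (windowMap_window h hy hδ rfl (Fin.cast hcard.symm j)).symm⟩

/-- Without any excitation, the columns of the stacked Hankel matrix are windows of the system. -/
theorem colsp_stackedHankel_le_range
    (h : ∀ k, x (k + 1) = J.mulVec (x k) + B.mulVec (v k))
    (hy : ∀ k, y k = C.mulVec (x k) + ∑ i ∈ Finset.range δ, (D i).mulVec (v (k + i)))
    (hδ : 0 < δ) (M : ℕ) :
    colsp (stackedHankel L M v y) ≤ LinearMap.range (windowMap J B C D (L + δ - 1) δ L) := by
  rw [colsp, Submodule.span_le]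
  rintro _ ⟨j, rfl⟩
  exact ⟨_, windowMap_window h hy hδ rfl j⟩

end Window

/-! ### Random trajectories -/

section Random

variable {Ω : Type*} [MeasurableSpace Ω] {P : Measure Ω}

theorem pceCoeff_congr (φ : ℕ → Lp ℝ 2 P) {m : ℕ} {Z Z' : Ω → Fin m → ℝ} (h : Z =ᵐ[P] Z')
    (i : ℕ) : pceCoeff P φ Z i = pceCoeff P φ Z' i := by
  ext j
  unfold pceCoeff
  congr 1
  refine integral_congr_ae ?_
  filter_upwards [h] with ω hω
  rw [hω]

theorem integrable_basis_mul (φ : ℕ → Lp ℝ 2 P) {m : ℕ} {Z : Ω → Fin m → ℝ}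
    (hZ : MemLp Z 2 P) (i : ℕ) (j : Fin m) : Integrable (fun ω => φ i ω * Z ω j) P :=
  (Lp.memLp (φ i)).integrable_mul (hZ.eval j)

theorem pceCoeff_add (φ : ℕ → Lp ℝ 2 P) {m : ℕ} {Z Z' : Ω → Fin m → ℝ}
    (hZ : MemLp Z 2 P) (hZ' : MemLp Z' 2 P) (i : ℕ) :
    pceCoeff P φ (fun ω => Z ω + Z' ω) i = pceCoeff P φ Z i + pceCoeff P φ Z' i := by
  ext j
  simp only [pceCoeff, Pi.add_apply, mul_add]
  rw [integral_add (integrable_basis_mul φ hZ i j) (integrable_basis_mul φ hZ' i j), add_div]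

theorem pceCoeff_mulVec (φ : ℕ → Lp ℝ 2 P) {m n : ℕ} (M : Matrix (Fin n) (Fin m) ℝ)
    {Z : Ω → Fin m → ℝ} (hZ : MemLp Z 2 P) (i : ℕ) :
    pceCoeff P φ (fun ω => M.mulVec (Z ω)) i = M.mulVec (pceCoeff P φ Z i) := by
  ext j
  simp only [pceCoeff, Matrix.mulVec, dotProduct, Finset.mul_sum, mul_left_comm _ (M _ _)]
  rw [integral_finsetSum _ fun c _ => (integrable_basis_mul φ hZ i c).const_mul _,
    Finset.sum_div]
  simp only [integral_const_mul, mul_div_assoc]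

theorem MeasureTheory.MemLp.mulVec {m n : ℕ} (M : Matrix (Fin n) (Fin m) ℝ)
    {Z : Ω → Fin m → ℝ} (hZ : MemLp Z 2 P) : MemLp (fun ω => M.mulVec (Z ω)) 2 P :=
  M.mulVecLin.toContinuousLinearMap.comp_memLp' hZ

variable {nx nv ny : ℕ} {E A : Matrix (Fin nx) (Fin nx) ℝ} {B : Matrix (Fin nx) (Fin nv) ℝ}
  {C : Matrix (Fin ny) (Fin nx) ℝ} {D : Matrix (Fin ny) (Fin nv) ℝ}
  {V : ℕ → Ω → Fin nv → ℝ} {Y : ℕ → Ω → Fin ny → ℝ}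

theorem IsRandomIOTrajectory.pceCoeff (h : IsRandomIOTrajectory P E A B C D V Y)
    (φ : ℕ → Lp ℝ 2 P) (i : ℕ) :
    IsIOTrajectory E A B C D (fun k => pceCoeff P φ (V k) i)
      (fun k => pceCoeff P φ (Y k) i) := by
  obtain ⟨hV, hY, X, hX, hdyn, hout⟩ := h
  refine ⟨fun k => _root_.pceCoeff P φ (X k) i, fun k => ?_, fun k => ?_⟩
  · rw [← pceCoeff_mulVec φ E (hX _), ← pceCoeff_mulVec φ A (hX _), ← pceCoeff_mulVec φ B (hV _),
      ← pceCoeff_add φ ((hX k).mulVec A) ((hV k).mulVec B)]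
    exact pceCoeff_congr φ (hdyn k) i
  · rw [← pceCoeff_mulVec φ C (hX _), ← pceCoeff_mulVec φ D (hV _),
      ← pceCoeff_add φ ((hX k).mulVec C) ((hV k).mulVec D)]
    exact pceCoeff_congr φ (hout k) i

theorem IsRandomIOTrajectory.ae_isIOTrajectory (h : IsRandomIOTrajectory P E A B C D V Y) :
    ∀ᵐ ω ∂P, IsIOTrajectory E A B C D (fun k => V k ω) (fun k => Y k ω) := by
  obtain ⟨hV, hY, X, hX, hdyn, hout⟩ := h
  filter_upwards [ae_all_iff.2 hdyn, ae_all_iff.2 hout] with ω h1 h2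
  exact ⟨fun k => X k ω, h1, h2⟩

theorem memLp_stackedHankel_mulVec (hV : ∀ k, MemLp (V k) 2 P) (hY : ∀ k, MemLp (Y k) 2 P)
    (L M : ℕ) (g : Fin (M + 1 - L) → ℝ) :
    MemLp (fun ω => (stackedHankel L M (fun k => V k ω) (fun k => Y k ω)).mulVec g) 2 P := by
  rw [memLp_pi_iff]
  rintro (a | a) <;> simp only [Matrix.mulVec, dotProduct] <;>
    refine memLp_finsetSum _ fun j _ => MemLp.mul_const ?_ _
  · exact (hV _).eval _
  · exact (hY _).eval _

end Random

/-- Choosing preimages linearly, rather than pointwise in `ω`, gives measurability and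
square-integrability of `G` in finite dimension. -/
theorem LinearMap.exists_section_on_range {X Y : Type*} [AddCommGroup X] [Module ℝ X]
    [AddCommGroup Y] [Module ℝ Y] (f : X →ₗ[ℝ] Y) :
    ∃ r : Y →ₗ[ℝ] X, ∀ y ∈ LinearMap.range f, f (r y) = y := by
  obtain ⟨s, hs⟩ := f.rangeRestrict.exists_rightInverse_of_surjective f.range_rangeRestrict
  obtain ⟨r, hr⟩ := LinearMap.exists_extend s
  refine ⟨r, fun y hy => ?_⟩
  have h1 : r y = s ⟨y, hy⟩ := LinearMap.congr_fun hr ⟨y, hy⟩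
  rw [h1]
  exact congrArg Subtype.val (LinearMap.congr_fun hs ⟨y, hy⟩)

theorem mainTheorem7 {Ω : Type*} [MeasurableSpace Ω] (P : Measure Ω) [IsProbabilityMeasure P]
    (φ : ℕ → Lp ℝ 2 P) (hφ : IsOrthogonalBasisL2 P φ)
    (nx nv ny nJ δ L T : ℕ)
    (E A : Matrix (Fin nx) (Fin nx) ℝ) (B : Matrix (Fin nx) (Fin nv) ℝ)
    (C : Matrix (Fin ny) (Fin nx) ℝ) (D : Matrix (Fin ny) (Fin nv) ℝ)
    (hreg : IsRegularPencil E A) (hctrl : IsRControllable E A B)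
    (hdim : HasDynamicDimAndIndex E A B nJ δ)
    (V : ℕ → Ω → Fin nv → ℝ) (Y : ℕ → Ω → Fin ny → ℝ)
    (hVY : IsRandomIOTrajectory P E A B C D V Y)
    (vhat : ℕ → Fin nv → ℝ) (yhat : ℕ → Fin ny → ℝ)
    (hvy : IsIOTrajectory E A B C D vhat yhat)
    (hpe : IsPersistentlyExciting (L + nJ + δ - 1) T vhat)
    (hpeCoeff : ∀ i, IsPersistentlyExciting (L + nJ + δ - 1) T (fun k => pceCoeff P φ (V k) i)) :
    (∀ i, colsp (stackedHankel L (T + 1 - δ)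
          (fun k => pceCoeff P φ (V k) i) (fun k => pceCoeff P φ (Y k) i)) =
        colsp (stackedHankel L (T + 1 - δ) vhat yhat)) ∧
    (∀ g : Fin (T + 1 - δ + 1 - L) → ℝ,
      ∃ G : Ω → Fin (T + 1 - δ + 1 - L) → ℝ, MemLp G 2 P ∧
        ∀ᵐ ω ∂P,
          (stackedHankel L (T + 1 - δ) (fun k => V k ω) (fun k => Y k ω)).mulVec g =
            (stackedHankel L (T + 1 - δ) vhat yhat).mulVec (G ω)) := by
  obtain ⟨nN, F, rfl⟩ := hdim
  have hδ := (F.structuredIndex_spec B).1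
  obtain ⟨CJ, K, hform⟩ := F.exists_output_form B C D
  have hF := fun a => F.vecMul_eq_zero_of_isRControllable hctrl (a := a)
  rcases Nat.eq_zero_or_pos L with rfl | hL
  -- For `L = 0` the Hankel matrices have no rows.
  · exact ⟨fun i => Subsingleton.elim _ _, fun g => ⟨0, MemLp.zero,
      Filter.Eventually.of_forall fun ω => Subsingleton.elim _ _⟩⟩
  obtain ⟨xhat, hx, hy⟩ := hform _ _ hvy
  have hhat := colsp_stackedHankel_eq_range hF hx hy hδ hL hpe
  constructor
  · intro i
    obtain ⟨x, hx', hy'⟩ := hform _ _ (hVY.pceCoeff φ i)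
    rw [hhat, colsp_stackedHankel_eq_range hF hx' hy' hδ hL (hpeCoeff i)]
  · intro g
    obtain ⟨r, hr⟩ := (stackedHankel L (T + 1 - F.structuredIndex B) vhat
      yhat).mulVecLin.exists_section_on_range
    refine ⟨_, r.toContinuousLinearMap.comp_memLp'
      (memLp_stackedHankel_mulVec hVY.1 hVY.2.1 L (T + 1 - F.structuredIndex B) g), ?_⟩
    filter_upwards [hVY.ae_isIOTrajectory] with ω hω
    obtain ⟨x, hx', hy'⟩ := hform _ _ hω
    refine (hr _ ?_).symm
    rw [Matrix.range_mulVecLin]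
    -- Only the inclusion of the sample windows in the range is needed, so the sample path itself
    -- need not be exciting.
    refine hhat.symm.le (colsp_stackedHankel_le_range hx' hy' hδ (T + 1 - F.structuredIndex B) ?_)
    rw [colsp, ← Matrix.range_mulVecLin]
    exact ⟨g, rfl⟩
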